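/- \textbf{Theorem (finite-time breakdown, repulsive case).} Let $\nu\ge 0$ and $0<c_-\le c_+$, and let $c:[0,\infty)\times\mathbb R\to\mathbb R$ be a continuous background with $c_-\le c(t,x)\le c_+$ for all $(t,x)$. Consider the repulsive Euler--Poisson system $$\partial_t\rho+\partial_x(\rho u)=0,\qquad \partial_t u+u\,\partial_x u=-\nu u-\partial_x\phi,\qquad -\partial_{xx}\phi=\rho-c \qquad\text{in }(0,T)\times\mathbb R,$$ with initial data $(\rho,u)(0,\cdot)=(\rho_0,u_0)$. A function $f$ is said to be of class $\mathcal C^1$ on $[0,T)\times\mathbb R$ if it is continuously differentiable there and $|f|+|\partial_t f|+|\partial_x f|$ is bounded on $[0,T']\times\mathbb R$ for every $T'<T$; a $\mathcal C^1$ solution on $[0,T)$ is a pair $(\rho,u)$ of functions of class $\mathcal C^1$ on $[0,T)\times\mathbb R$ that satisfies the system pointwise for some potential $\phi$. Let $P_-$ be the maximal nonnegative solution of $$\frac{dP}{ds}=\nu\sqrt{2P}+1-c_-s,\qquad P(0)=0,$$ and, when $\nu<2\sqrt{c_-}$, let $N_+$ be the maximal nonnegative solution of $$\frac{dN}{ds}=-\nu\sqrt{2N}+1-c_+s,\qquad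 N(s_*)=0,\qquad s_*:=\frac{1}{c_-}\Bigl(1+\exp\Bigl(\tfrac{\pi\nu}{\sqrt{4c_--\nu^2}}\Bigr)\Bigr).$$ Suppose that there is a point $x\in\mathbb R$ with $\rho_0(x)>0$ at which the following condition fails: - if $\nu\ge 2\sqrt{c_-}$: $\quad -\rho_0(x)\sqrt{2P_-(1/\rho_0(x))}<u_0'(x)$; - if $0\le\nu<2\sqrt{c_-}$: $\quad -\rho_0(x)\sqrt{2P_-(1/\rho_0(x))}<u_0'(x)<\rho_0(x)\sqrt{2N_+(1/\rho_0(x))}$. Here the condition also counts as failing if $1/\rho_0(x)$ lies outside the domain of a function that occurs in it. Then the $\mathcal C^1$ regularity is lost in finite time: there is $T_*\in(0,\infty)$ such that every $\mathcal C^1$ solution on $[0,T)$ with initial data $(\rho_0,u_0)$ has $T\le T_*$. -/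

import Mathlib

open Set

noncomputable section

namespace EulerPoisson

/-- `f` is of class `C¹` on `[0,T) × ℝ`: it is continuously differentiable there (one-sidedly in
time at `t = 0`), and `|f| + |∂ₜ f| + |∂ₓ f|` is bounded on `[0,T'] × ℝ` for every `T' < T`. -/
def IsClassC1 (T : ℝ) (f : ℝ → ℝ → ℝ) : Prop :=
  ContDiffOn ℝ 1 (Function.uncurry f) (Ico 0 T ×ˢ univ) ∧
  ∀ T' < T, ∃ M : ℝ, ∀ t ∈ Icc 0 T', ∀ x : ℝ,
    |f t x| + |derivWithin (fun τ => f τ x) (Ico 0 T) t| + |deriv (f t) x| ≤ M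

/-- `(ρ, u)` is a `C¹` solution on `[0,T) × ℝ` of the damped pressureless Euler-Poisson system with
forcing constant `k`, damping `ν` and background `c`, for some potential `φ`:
`∂ₜρ + ∂ₓ(ρu) = 0`, `∂ₜu + u ∂ₓu = -νu - k ∂ₓφ`, `-∂ₓₓφ = ρ - c` pointwise in `(0,T) × ℝ`.
The first argument of every function is time, the second one is space. -/
def IsC1Solution (k ν : ℝ) (c : ℝ → ℝ → ℝ) (T : ℝ) (ρ u : ℝ → ℝ → ℝ) : Prop :=
  0 < T ∧ IsClassC1 T ρ ∧ IsClassC1 T u ∧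
  ∃ φ : ℝ → ℝ → ℝ, ∀ t ∈ Ioo 0 T, ∀ x : ℝ,
    deriv (fun τ => ρ τ x) t + deriv (fun y => ρ t y * u t y) x = 0 ∧
    deriv (fun τ => u τ x) t + u t x * deriv (u t) x = -ν * u t x - k * deriv (φ t) x ∧
    DifferentiableAt ℝ (φ t) x ∧
    HasDerivAt (deriv (φ t)) (-(ρ t x - c t x)) x

/-- `f` is a nonnegative solution of `y' = F s y`, `y a = 0`, on the closed interval with
endpoints `a` and `b` (one-sided derivatives at the endpoints). -/
def SolvesOn (F : ℝ → ℝ → ℝ) (a b : ℝ) (f : ℝ → ℝ) : Prop :=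
  f a = 0 ∧ ∀ s ∈ uIcc a b, 0 ≤ f s ∧ HasDerivWithinAt f (F s (f s)) (uIcc a b) s

/-- The domain of the maximal nonnegative solution of `y' = F s y`, `y a = 0`. -/
def solDom (F : ℝ → ℝ → ℝ) (a : ℝ) : Set ℝ :=
  {s | ∃ f, SolvesOn F a s f}

open Classical in
/-- The maximal nonnegative solution of `y' = F s y`, `y a = 0`: its value at `s ∈ solDom F a` is
the value at `s` of a solution on the interval between `a` and `s`. -/
def maxSol (F : ℝ → ℝ → ℝ) (a : ℝ) (s : ℝ) : ℝ :=
  if h : s ∈ solDom F a then h.choose s else 0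

/-- Right-hand side of `dP/ds = ν √(2P) + 1 - c s`. -/
def fieldP (ν c s y : ℝ) : ℝ := ν * √(2 * y) + 1 - c * s

/-- Right-hand side of `dN/ds = -ν √(2N) + 1 - c s`. -/
def fieldN (ν c s y : ℝ) : ℝ := -ν * √(2 * y) + 1 - c * s

/-- Domain of `P`, the maximal solution of `dP/ds = ν √(2P) + 1 - c s`, `P(0) = 0`. -/
def domP (ν c : ℝ) : Set ℝ := solDom (fieldP ν c) 0

/-- `P`, the maximal solution of `dP/ds = ν √(2P) + 1 - c s`, `P(0) = 0`. -/
def P (ν c : ℝ) : ℝ → ℝ := maxSol (fieldP ν c) 0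

/-- `s̃ = (1 + e^γ) / c`, `γ = π ν / √(4c - ν²)`, used only for `0 ≤ ν < 2√c`. -/
def sTilde (ν c : ℝ) : ℝ := (1 + Real.exp (Real.pi * ν / √(4 * c - ν ^ 2))) / c

/-- Domain of `N`, the maximal solution of `dN/ds = -ν √(2N) + 1 - c s`, `N(sStar) = 0`. -/
def domN (ν c sStar : ℝ) : Set ℝ := solDom (fieldN ν c) sStar

/-- `N`, the maximal solution of `dN/ds = -ν √(2N) + 1 - c s`, `N(sStar) = 0`. -/
def N (ν c sStar : ℝ) : ℝ → ℝ := maxSol (fieldN ν c) sStar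

end EulerPoisson

end

/-
Along a characteristic, `s = 1 / ρ` and `p = s ∂ₓu` satisfy `s' = p`, `p' = 1 - ν p - c s`, and a
`C¹` solution keeps `s` positive and finite. For a constant coefficient `c₋` or `c₊`, run the
oscillator `s'' + ν s' + c s = 1` backwards in time from rest: at `s = 0` with `c₋`, at `s = s_*`
with `c₊`. The kinetic energies `p² / 2` on these orbits, as functions of `s`, are `P₋` and `N₊`.
Wherever the impulse response is positive, Duhamel's formula compares the variable coefficient with
the constant one. Starting with `p ≤ -√(2 P₋)`, the trajectory lies below the oscillator with `c₋`,
which reaches `0`. Starting with `p ≥ √(2 N₊)`, it lies above the oscillator with `c₊` and so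
reaches `s_*`; from `s ≥ s_*` the oscillator with `c₋` is driven to `0` within half a period,
whatever its velocity.
-/

namespace EulerPoisson

open Filter Topology

theorem map_nhdsWithin_eq_nhdsWithin_image {X Y : Type*} [TopologicalSpace X] [TopologicalSpace Y]
    [T2Space Y] {f : X → Y} {K : Set X} (hK : IsCompact K) (hf : ContinuousOn f K)
    (hinj : InjOn f K) {x : X} (hx : x ∈ K) : map f (𝓝[K] x) = 𝓝[f '' K] (f x) := by
  have : CompactSpace K := isCompact_iff_compactSpace.1 hK
  have hemb : IsClosedEmbedding (K.domRestrict f) :=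
    hf.domRestrict.isClosedEmbedding hinj.injective
  rw [nhdsWithin_eq_map_subtype_coe hx, map_map]
  exact (hemb.isEmbedding.map_nhds_eq ⟨x, hx⟩).trans (by rw [range_domRestrict]; rfl)

theorem injOn_Icc_of_hasDerivAt_ne_zero {f f' : ℝ → ℝ} {a b : ℝ} (hf : ContinuousOn f (Icc a b))
    (hf' : ∀ t ∈ Ioo a b, HasDerivAt f (f' t) t) (hne : ∀ t ∈ Ioo a b, f' t ≠ 0) :
    InjOn f (Icc a b) := by
  refine injOn_iff_pairwise_ne.2 fun x hx y hy hxy => ?_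
  wlog hlt : x < y generalizing x y
  · exact (this y hy x hx hxy.symm (hxy.symm.lt_of_le (not_lt.1 hlt))).symm
  intro heq
  obtain ⟨ξ, hξ, h0⟩ := exists_hasDerivAt_eq_zero hlt (hf.mono (Icc_subset_Icc hx.1 hy.2)) heq
    fun t ht => hf' t (Ioo_subset_Ioo hx.1 hy.2 ht)
  exact hne ξ (Ioo_subset_Ioo hx.1 hy.2 hξ) h0

theorem exists_mem_uIcc_sub_eq_mul_sub {S Y V m : ℝ → ℝ} {a b x y : ℝ}
    (hS : ∀ t ∈ Icc a b, HasDerivAt S (V t) t) (hY : ∀ t ∈ Icc a b, HasDerivAt Y (V t * m t) t)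
    (hV : ∀ t ∈ Ioo a b, V t ≠ 0) (hx : x ∈ Icc a b) (hy : y ∈ Icc a b) :
    ∃ ξ ∈ uIcc x y, Y y - Y x = m ξ * (S y - S x) := by
  wlog hlt : x < y generalizing x y
  · rcases (not_lt.1 hlt).eq_or_lt with rfl | hlt
    · exact ⟨y, left_mem_uIcc, by simp⟩
    · obtain ⟨ξ, hξ, h⟩ := this hy hx hlt
      exact ⟨ξ, uIcc_comm x y ▸ hξ, by linear_combination -h⟩
  have hsub : Icc x y ⊆ Icc a b := Icc_subset_Icc hx.1 hy.2
  have hsub' : Ioo x y ⊆ Icc a b := Ioo_subset_Icc_self.trans hsub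
  obtain ⟨ξ, hξ, h⟩ := exists_ratio_hasDerivAt_eq_ratio_slope S V hlt
    (fun t ht => (hS t (hsub ht)).continuousAt.continuousWithinAt) (fun t ht => hS t (hsub' ht))
    Y (fun t => V t * m t) (fun t ht => (hY t (hsub ht)).continuousAt.continuousWithinAt)
    (fun t ht => hY t (hsub' ht))
  refine ⟨ξ, Icc_subset_uIcc (Ioo_subset_Icc_self hξ), ?_⟩
  refine mul_right_cancel₀ (hV ξ (Ioo_subset_Ioo hx.1 hy.2 hξ)) ?_
  linear_combination h

/- The speed `V` may vanish at the endpoints, so the derivative of `S⁻¹` may blow up there; the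
ratio form of the mean value theorem avoids it. -/
theorem hasDerivWithinAt_image_of_comp_eqOn {S Y V m f : ℝ → ℝ} {a b r : ℝ}
    (hS : ∀ t ∈ Icc a b, HasDerivAt S (V t) t) (hY : ∀ t ∈ Icc a b, HasDerivAt Y (V t * m t) t)
    (hV : ∀ t ∈ Ioo a b, V t ≠ 0) (hm : ContinuousOn m (Icc a b))
    (hf : EqOn (f ∘ S) Y (Icc a b)) (hr : r ∈ Icc a b) :
    HasDerivWithinAt f (m r) (S '' Icc a b) (S r) := by
  have hScont : ContinuousOn S (Icc a b) := fun t ht => (hS t ht).continuousAt.continuousWithinAt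
  have hinj : InjOn S (Icc a b) :=
    injOn_Icc_of_hasDerivAt_ne_zero hScont (fun t ht => hS t (Ioo_subset_Icc_self ht)) hV
  rw [hasDerivWithinAt_iff_isLittleO, ← map_nhdsWithin_eq_nhdsWithin_image isCompact_Icc hScont
    hinj hr, Asymptotics.isLittleO_map, Asymptotics.isLittleO_iff]
  intro ε hε
  obtain ⟨δ, hδ, hmδ⟩ := Metric.continuousWithinAt_iff.1 (hm r hr) ε hε
  filter_upwards [self_mem_nhdsWithin, mem_nhdsWithin_of_mem_nhds (Metric.ball_mem_nhds r hδ)]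
    with x hx hxδ
  obtain ⟨ξ, hξ, hratio⟩ := exists_mem_uIcc_sub_eq_mul_sub hS hY hV hr hx
  have hmξ : dist (m ξ) (m r) < ε := hmδ (ordConnected_Icc.uIcc_subset hr hx hξ)
    ((convex_ball r δ).ordConnected.uIcc_subset (Metric.mem_ball_self hδ) hxδ hξ)
  have hfx : f (S x) - f (S r) = m ξ * (S x - S r) := by
    rw [← hratio]; exact congrArg₂ (· - ·) (hf hx) (hf hr)
  calc ‖f (S x) - f (S r) - (S x - S r) • m r‖ = ‖m ξ - m r‖ * ‖S x - S r‖ := by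
        rw [hfx, ← norm_mul, smul_eq_mul]; ring_nf
    _ ≤ ε * ‖S x - S r‖ := by
        rw [← dist_eq_norm]; gcongr

/-- A motion `S`, with velocity `V`, of `S'' = F(S, S'² / 2)` on `[0,r]` which starts at rest and
does not stop before `r`: its kinetic energy `S'² / 2`, as a function of the position `S`, solves
`dy/ds = F(s, y)`. -/
structure IsOrbit (F : ℝ → ℝ → ℝ) (r : ℝ) (S V : ℝ → ℝ) : Prop where
  hasDerivAt_position : ∀ t ∈ Icc 0 r, HasDerivAt S (V t) t
  hasDerivAt_velocity : ∀ t ∈ Icc 0 r, HasDerivAt V (F (S t) (V t ^ 2 / 2)) t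
  velocity_zero : V 0 = 0
  velocity_ne_zero : ∀ t ∈ Ioo 0 r, V t ≠ 0

namespace IsOrbit

variable {F : ℝ → ℝ → ℝ} {r : ℝ} {S V : ℝ → ℝ}

theorem continuousOn_position (h : IsOrbit F r S V) : ContinuousOn S (Icc 0 r) :=
  fun t ht => (h.hasDerivAt_position t ht).continuousAt.continuousWithinAt

theorem continuousOn_velocity (h : IsOrbit F r S V) : ContinuousOn V (Icc 0 r) :=
  fun t ht => (h.hasDerivAt_velocity t ht).continuousAt.continuousWithinAt

theorem injOn_position (h : IsOrbit F r S V) : InjOn S (Icc 0 r) :=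
  injOn_Icc_of_hasDerivAt_ne_zero h.continuousOn_position
    (fun t ht => h.hasDerivAt_position t (Ioo_subset_Icc_self ht)) h.velocity_ne_zero

theorem image_position (h : IsOrbit F r S V) (hr : 0 ≤ r) :
    S '' Icc 0 r = uIcc (S 0) (S r) := by
  have hcont := h.continuousOn_position
  rcases hcont.strictMonoOn_of_injOn_Icc' hr h.injOn_position with hmono | hanti
  · rw [← uIcc_of_le hr] at hcont hmono ⊢
    exact hcont.image_uIcc_of_monotoneOn hmono.monotoneOn
  · rw [← uIcc_of_le hr] at hcont hanti ⊢
    exact hcont.image_uIcc_of_antitoneOn hanti.antitoneOn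

theorem hasDerivAt_kineticEnergy (h : IsOrbit F r S V) {t : ℝ} (ht : t ∈ Icc 0 r) :
    HasDerivAt (fun t => V t ^ 2 / 2) (V t * F (S t) (V t ^ 2 / 2)) t :=
  (((h.hasDerivAt_velocity t ht).fun_pow 2).div_const 2).congr_deriv (by push_cast; ring)

theorem mem_solDom (h : IsOrbit F r S V) (hF : Continuous (Function.uncurry F)) (hr : 0 ≤ r) :
    S r ∈ solDom F (S 0) := by
  have hinv : ∀ t ∈ Icc 0 r, Function.invFunOn S (Icc 0 r) (S t) = t :=
    fun t ht => h.injOn_position.leftInvOn_invFunOn ht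
  have hforce : ContinuousOn (fun t => F (S t) (V t ^ 2 / 2)) (Icc 0 r) :=
    hF.comp_continuousOn (h.continuousOn_position.prodMk
      ((h.continuousOn_velocity.pow 2).div_const 2))
  refine ⟨fun s => V (Function.invFunOn S (Icc 0 r) s) ^ 2 / 2, ?_, fun s hs => ⟨by positivity, ?_⟩⟩
  · simp only [hinv 0 (left_mem_Icc.2 hr), h.velocity_zero]
    norm_num
  · rw [← h.image_position hr] at hs ⊢
    obtain ⟨t, ht, rfl⟩ := hs
    simp only [hinv t ht]
    exact hasDerivWithinAt_image_of_comp_eqOn h.hasDerivAt_position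
      (fun t ht => h.hasDerivAt_kineticEnergy ht) h.velocity_ne_zero hforce
      (fun t ht => by simp only [Function.comp_apply, hinv t ht]) ht

end IsOrbit

theorem abs_mul_abs_abs_sub_sqrt_two_mul_le {v y : ℝ} (hy : 0 ≤ y) :
    |v| * |(|v|) - √(2 * y)| ≤ 2 * |v ^ 2 / 2 - y| := by
  have hsq : √(2 * y) ^ 2 = 2 * y := Real.sq_sqrt (by positivity)
  have hfactor : 2 * (v ^ 2 / 2 - y) = (|v| + √(2 * y)) * (|v| - √(2 * y)) := by
    rw [← sq_abs v]
    linear_combination hsq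
  calc |v| * |(|v|) - √(2 * y)| ≤ (|v| + √(2 * y)) * |(|v|) - √(2 * y)| := by
        gcongr
        exact le_add_of_nonneg_right (Real.sqrt_nonneg _)
    _ = |2 * (v ^ 2 / 2 - y)| := by
        rw [hfactor, abs_mul, abs_of_nonneg (a := |v| + _) (by positivity)]
    _ = 2 * |v ^ 2 / 2 - y| := by rw [abs_mul, abs_two]

theorem exists_solvesOn_maxSol_eq {F : ℝ → ℝ → ℝ} {a s : ℝ} (h : s ∈ solDom F a) :
    ∃ f, SolvesOn F a s f ∧ maxSol F a s = f s :=
  ⟨h.choose, h.choose_spec, by simp only [maxSol, h, ↓reduceDIte]⟩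

namespace IsOrbit

variable {F : ℝ → ℝ → ℝ} {r K : ℝ} {S V f : ℝ → ℝ}

/- `F(s, ·)` need not be Lipschitz at `0`, but the energy gap satisfies a linear differential
inequality in time, because `d/dt = V d/ds` and `|V|` absorbs the square root. -/
theorem eq_of_solvesOn (h : IsOrbit F r S V) (hr : 0 ≤ r) (hK : 0 ≤ K)
    (hLip : ∀ s y z, |F s y - F s z| ≤ K * |√(2 * y) - √(2 * z)|)
    (hf : SolvesOn F (S 0) (S r) f) : f (S r) = V r ^ 2 / 2 := by
  have hmaps : MapsTo S (Icc 0 r) (uIcc (S 0) (S r)) :=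
    mapsTo_iff_image_subset.2 (h.image_position hr).subset
  have hgap : ∀ t ∈ Icc 0 r, HasDerivWithinAt (fun t => V t ^ 2 / 2 - f (S t))
      (V t * (F (S t) (V t ^ 2 / 2) - F (S t) (f (S t)))) (Icc 0 r) t := fun t ht =>
    ((h.hasDerivAt_kineticEnergy ht).hasDerivWithinAt.sub (((hf.2 _ (hmaps ht)).2).comp t
      (h.hasDerivAt_position t ht).hasDerivWithinAt hmaps)).congr_deriv (by ring)
  have hbound : ∀ t ∈ Icc 0 r, ‖V t * (F (S t) (V t ^ 2 / 2) - F (S t) (f (S t)))‖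
      ≤ 2 * K * ‖V t ^ 2 / 2 - f (S t)‖ := fun t ht => by
    have hsqrt : √(2 * (V t ^ 2 / 2)) = |V t| := by
      rw [mul_div_cancel₀ _ (two_ne_zero' ℝ), Real.sqrt_sq_eq_abs]
    calc ‖V t * (F (S t) (V t ^ 2 / 2) - F (S t) (f (S t)))‖
        ≤ |V t| * (K * |(|V t|) - √(2 * f (S t))|) := by
          rw [Real.norm_eq_abs, abs_mul, ← hsqrt]
          gcongr
          exact hLip _ _ _
      _ = K * (|V t| * |(|V t|) - √(2 * f (S t))|) := by ring
      _ ≤ K * (2 * |V t ^ 2 / 2 - f (S t)|) :=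
          mul_le_mul_of_nonneg_left (abs_mul_abs_abs_sub_sqrt_two_mul_le (hf.2 _ (hmaps ht)).1) hK
      _ = 2 * K * ‖V t ^ 2 / 2 - f (S t)‖ := by rw [Real.norm_eq_abs]; ring
  have hzero := eq_zero_of_abs_deriv_le_mul_abs_self_of_eq_zero_right
    (fun t ht => (hgap t ht).continuousWithinAt)
    (fun t ht => (hgap t (Ico_subset_Icc_self ht)).mono_of_mem_nhdsWithin
      (mem_of_superset (Icc_mem_nhdsGE ht.2) (Icc_subset_Icc_left ht.1)))
    (by simp [h.velocity_zero, hf.1]) (fun t ht => hbound t (Ico_subset_Icc_self ht))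
    r (right_mem_Icc.2 hr)
  linarith

theorem maxSol_eq (h : IsOrbit F r S V) (hF : Continuous (Function.uncurry F)) (hr : 0 ≤ r)
    (hK : 0 ≤ K) (hLip : ∀ s y z, |F s y - F s z| ≤ K * |√(2 * y) - √(2 * z)|) :
    maxSol F (S 0) (S r) = V r ^ 2 / 2 := by
  obtain ⟨f, hf, hmax⟩ := exists_solvesOn_maxSol_eq (h.mem_solDom hF hr)
  exact hmax.trans (h.eq_of_solvesOn hr hK hLip hf)

end IsOrbit

/-- The response `E` of the oscillator `E'' + ν E' + c E = 1` to a unit step switched on at rest,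
with its velocity `G = E'`, which is also the impulse response. -/
structure IsStepResponse (ν c : ℝ) (E G : ℝ → ℝ) : Prop where
  hasDerivAt_position : ∀ t, HasDerivAt E (G t) t
  hasDerivAt_velocity : ∀ t, HasDerivAt G (1 - ν * G t - c * E t) t
  position_zero : E 0 = 0
  velocity_zero : G 0 = 0

/-- The solution of `s'' + ν s' + c s = 1`, `s 0 = s₀`, `s' 0 = p₀`, in terms of the step response
`E` of that oscillator and its velocity `G`. -/
def response (c : ℝ) (E G : ℝ → ℝ) (s₀ p₀ t : ℝ) : ℝ :=
  s₀ + p₀ * G t + (1 - c * s₀) * E t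

theorem response_zero_zero (c : ℝ) (E G : ℝ → ℝ) (t : ℝ) : response c E G 0 0 t = E t := by
  simp only [response, mul_zero, sub_zero, zero_mul, add_zero, zero_add, one_mul]

/-- A positive trajectory on `[0,b]`, with position `s` and velocity `p`, of the differential
inclusion `s'' + ν s' + K s ∋ 1`, in which the stiffness may take any value in `K` at each time. -/
structure IsTrajectory (ν : ℝ) (K : Set ℝ) (b : ℝ) (s p : ℝ → ℝ) : Prop where
  continuousOn_position : ContinuousOn s (Icc 0 b)
  continuousOn_velocity : ContinuousOn p (Icc 0 b)
  hasDerivAt_position : ∀ t ∈ Ioo 0 b, HasDerivAt s (p t) t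
  exists_hasDerivAt_velocity : ∀ t ∈ Ioo 0 b, ∃ k ∈ K, HasDerivAt p (1 - ν * p t - k * s t) t
  pos : ∀ t ∈ Icc 0 b, 0 < s t

/-- No positive trajectory of `s'' + ν s' + K s ∋ 1` with data `(s₀, p₀)` lives up to time `T`. -/
def BreaksDownBefore (ν : ℝ) (K : Set ℝ) (s₀ p₀ T : ℝ) : Prop :=
  ∀ b s p, IsTrajectory ν K b s p → s 0 = s₀ → p 0 = p₀ → b < T

namespace IsTrajectory

variable {ν b : ℝ} {K K' : Set ℝ} {s p : ℝ → ℝ}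

theorem mono (h : IsTrajectory ν K b s p) (hK : K ⊆ K') : IsTrajectory ν K' b s p where
  __ := h
  exists_hasDerivAt_velocity t ht :=
    (h.exists_hasDerivAt_velocity t ht).imp fun _ hk => ⟨hK hk.1, hk.2⟩

theorem shift (h : IsTrajectory ν K b s p) {t₀ : ℝ} (ht₀ : 0 ≤ t₀) :
    IsTrajectory ν K (b - t₀) (fun t => s (t₀ + t)) (fun t => p (t₀ + t)) := by
  have hIcc : MapsTo (t₀ + ·) (Icc 0 (b - t₀)) (Icc 0 b) := fun t ht =>
    ⟨by linarith [ht.1], by linarith [ht.2]⟩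
  have hIoo : MapsTo (t₀ + ·) (Ioo 0 (b - t₀)) (Ioo 0 b) := fun t ht =>
    ⟨by linarith [ht.1], by linarith [ht.2]⟩
  have hcont : Continuous (t₀ + ·) := continuous_const_add t₀
  exact
    { continuousOn_position := h.continuousOn_position.comp hcont.continuousOn hIcc
      continuousOn_velocity := h.continuousOn_velocity.comp hcont.continuousOn hIcc
      hasDerivAt_position := fun t ht => (h.hasDerivAt_position _ (hIoo ht)).comp_const_add t₀ t
      exists_hasDerivAt_velocity := fun t ht =>
        (h.exists_hasDerivAt_velocity _ (hIoo ht)).imp fun _ hk =>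
          ⟨hk.1, hk.2.comp_const_add t₀ t⟩
      pos := fun t ht => h.pos _ (hIcc ht) }

end IsTrajectory

theorem BreaksDownBefore.mono {ν s₀ p₀ T : ℝ} {K K' : Set ℝ} (h : BreaksDownBefore ν K' s₀ p₀ T)
    (hK : K ⊆ K') : BreaksDownBefore ν K s₀ p₀ T :=
  fun b s p hs => h b s p (hs.mono hK)

namespace IsStepResponse

variable {ν c : ℝ} {E G : ℝ → ℝ}

theorem continuous_position (h : IsStepResponse ν c E G) : Continuous E :=
  continuous_iff_continuousAt.2 fun t => (h.hasDerivAt_position t).continuousAt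

theorem continuous_velocity (h : IsStepResponse ν c E G) : Continuous G :=
  continuous_iff_continuousAt.2 fun t => (h.hasDerivAt_velocity t).continuousAt

theorem response_zero (h : IsStepResponse ν c E G) (s₀ p₀ : ℝ) : response c E G s₀ p₀ 0 = s₀ := by
  simp only [response, h.position_zero, h.velocity_zero, mul_zero, add_zero]

theorem continuous_response (h : IsStepResponse ν c E G) (s₀ p₀ : ℝ) :
    Continuous (response c E G s₀ p₀) :=
  (continuous_const.add (h.continuous_velocity.const_mul p₀)).add
    (h.continuous_position.const_mul (1 - c * s₀))

/- The derivative of Duhamel's formula: follow the trajectory up to time `t`, then let the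
oscillator with constant coefficient `c` run until time `e`. -/
theorem hasDerivAt_response_along (h : IsStepResponse ν c E G) {s p : ℝ → ℝ} {k t : ℝ} (e : ℝ)
    (hs : HasDerivAt s (p t) t) (hp : HasDerivAt p (1 - ν * p t - k * s t) t) :
    HasDerivAt (fun t => response c E G (s t) (p t) (e - t)) ((c - k) * s t * G (e - t)) t :=
  ((hs.add (hp.mul ((h.hasDerivAt_velocity (e - t)).comp_const_sub e t))).add
    (((hs.const_mul c).const_sub 1).mul
      ((h.hasDerivAt_position (e - t)).comp_const_sub e t))).congr_deriv (by ring)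

theorem continuousOn_response_along (h : IsStepResponse ν c E G) {s p : ℝ → ℝ} {b : ℝ}
    {K : Set ℝ} (hs : IsTrajectory ν K b s p) (e : ℝ) :
    ContinuousOn (fun t => response c E G (s t) (p t) (e - t)) (Icc 0 b) := by
  have hsub : Continuous fun t : ℝ => e - t := continuous_sub_left e
  exact (hs.continuousOn_position.add (hs.continuousOn_velocity.mul
    (h.continuous_velocity.comp hsub).continuousOn)).add ((continuousOn_const.sub
    (hs.continuousOn_position.const_mul c)).mul (h.continuous_position.comp hsub).continuousOn)

theorem hasDerivAt_response_at_rest (h : IsStepResponse ν c E G) (a t : ℝ) :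
    HasDerivAt (response c E G a 0) ((1 - c * a) * G t) t :=
  (((h.hasDerivAt_velocity t).const_mul 0).const_add a |>.add
    ((h.hasDerivAt_position t).const_mul (1 - c * a))).congr_deriv (by ring)

theorem response_neg_rewind (h : IsStepResponse ν c E G) (a t : ℝ) :
    response c E G (response c E G a 0 t) ((1 - c * a) * G t) (-t) = a := by
  have hderiv : ∀ τ, HasDerivAt
      (fun τ => response c E G (response c E G a 0 τ) ((1 - c * a) * G τ) (0 - τ)) 0 τ := fun τ =>
    (h.hasDerivAt_response_along 0 (k := c) (h.hasDerivAt_response_at_rest a τ)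
      (((h.hasDerivAt_velocity τ).const_mul (1 - c * a)).congr_deriv
        (by simp only [response]; ring))).congr_deriv (by ring)
  have hconst := is_const_of_deriv_eq_zero (fun τ => (hderiv τ).differentiableAt)
    (fun τ => (hderiv τ).deriv) t 0
  simpa only [zero_sub, neg_zero, h.response_zero] using hconst

theorem exists_sub_response_eq (h : IsStepResponse ν c E G) {s p : ℝ → ℝ} {b t : ℝ} {K : Set ℝ}
    (hs : IsTrajectory ν K b s p) (ht : 0 < t) (htb : t ≤ b) :
    ∃ k ∈ K, ∃ τ ∈ Ioo 0 t,
      s t - response c E G (s 0) (p 0) t = (c - k) * (t * s τ * G (t - τ)) := by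
  have hderiv : ∀ τ ∈ Ioo 0 t, ∃ k ∈ K,
      HasDerivAt (fun τ => response c E G (s τ) (p τ) (t - τ)) ((c - k) * s τ * G (t - τ)) τ :=
    fun τ hτ => (hs.exists_hasDerivAt_velocity τ ⟨hτ.1, hτ.2.trans_le htb⟩).imp fun _ hk =>
      ⟨hk.1, h.hasDerivAt_response_along t
        (hs.hasDerivAt_position τ ⟨hτ.1, hτ.2.trans_le htb⟩) hk.2⟩
  obtain ⟨τ, hτ, hslope⟩ := exists_deriv_eq_slope _ ht
    ((h.continuousOn_response_along hs t).mono (Icc_subset_Icc_right htb))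
    fun τ hτ => (hderiv τ hτ).choose_spec.2.differentiableAt.differentiableWithinAt
  obtain ⟨k, hk, hkτ⟩ := hderiv τ hτ
  refine ⟨k, hk, τ, hτ, ?_⟩
  rw [hkτ.deriv, sub_self, sub_zero, h.response_zero, eq_div_iff ht.ne'] at hslope
  linear_combination -hslope

theorem trajectory_le_response (h : IsStepResponse ν c E G) {s p : ℝ → ℝ} {b t : ℝ}
    (hs : IsTrajectory ν (Ici c) b s p) (ht : 0 < t) (htb : t ≤ b)
    (hG : ∀ τ ∈ Ioo 0 t, 0 < G τ) : s t ≤ response c E G (s 0) (p 0) t := by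
  obtain ⟨k, hk, τ, hτ, heq⟩ := h.exists_sub_response_eq hs ht htb
  have hsτ := hs.pos τ ⟨hτ.1.le, hτ.2.le.trans htb⟩
  have hGτ := hG (t - τ) ⟨sub_pos.2 hτ.2, sub_lt_self t hτ.1⟩
  rw [← sub_nonpos, heq]
  exact mul_nonpos_of_nonpos_of_nonneg (sub_nonpos.2 hk) (by positivity)

theorem response_le_trajectory (h : IsStepResponse ν c E G) {s p : ℝ → ℝ} {b t : ℝ}
    (hs : IsTrajectory ν (Iic c) b s p) (ht : 0 < t) (htb : t ≤ b)
    (hG : ∀ τ ∈ Ioo 0 t, 0 < G τ) : response c E G (s 0) (p 0) t ≤ s t := by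
  obtain ⟨k, hk, τ, hτ, heq⟩ := h.exists_sub_response_eq hs ht htb
  have hsτ := hs.pos τ ⟨hτ.1.le, hτ.2.le.trans htb⟩
  have hGτ := hG (t - τ) ⟨sub_pos.2 hτ.2, sub_lt_self t hτ.1⟩
  rw [← sub_nonneg, heq]
  exact mul_nonneg (sub_nonneg.2 hk) (by positivity)

theorem breaksDownBefore_of_response_nonpos (h : IsStepResponse ν c E G) {s₀ p₀ r : ℝ} (hr : 0 < r)
    (hG : ∀ t ∈ Ioo 0 r, 0 < G t) (hs₀ : response c E G s₀ p₀ r ≤ 0) :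
    BreaksDownBefore ν (Ici c) s₀ p₀ r := by
  rintro b s p hs rfl rfl
  by_contra! hb
  exact (hs.pos r ⟨hr.le, hb⟩).not_ge ((h.trajectory_le_response hs hr hb hG).trans hs₀)

theorem breaksDownBefore_of_velocity_le (h : IsStepResponse ν c E G) {p₀ r : ℝ} (hr : 0 < r)
    (hG : ∀ t ∈ Ioo 0 r, 0 < G t) (hGr : 0 ≤ G r) (hp₀ : p₀ ≤ G (-r)) :
    BreaksDownBefore ν (Ici c) (E (-r)) p₀ r := by
  have hrewind := h.response_neg_rewind 0 (-r)
  have hdefect : p₀ * G r ≤ G (-r) * G r := mul_le_mul_of_nonneg_right hp₀ hGr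
  refine h.breaksDownBefore_of_response_nonpos hr hG ?_
  simp only [response, neg_neg] at hrewind ⊢
  linarith

theorem breaksDownBefore_of_velocity_ge (h : IsStepResponse ν c E G) {K : Set ℝ} {a p₀ q L : ℝ}
    (hK : K ⊆ Iic c) (hq : 0 < q) (hG : ∀ t ∈ Ioo 0 q, 0 < G t) (hGq : 0 ≤ G q) (hL : 0 ≤ L)
    (ha : ∀ s₀ p₀, a ≤ s₀ → BreaksDownBefore ν K s₀ p₀ L) (hp₀ : (1 - c * a) * G (-q) ≤ p₀) :
    BreaksDownBefore ν K (response c E G a 0 (-q)) p₀ (q + L) := by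
  rintro b s p hs hs₀ rfl
  by_contra! hb
  have hqa : a ≤ s q := calc
    a = response c E G (response c E G a 0 (-q)) ((1 - c * a) * G (-q)) q := by
      simpa only [neg_neg] using (h.response_neg_rewind a (-q)).symm
    _ ≤ response c E G (s 0) (p 0) q := by
      rw [hs₀]
      simp only [response]
      gcongr
    _ ≤ s q := h.response_le_trajectory (hs.mono hK) hq (by linarith) hG
  have hshift := ha (s q) (p q) hqa (b - q) _ _ (hs.shift hq.le)
    (by simp only [add_zero]) (by simp only [add_zero])
  linarith

end IsStepResponse

theorem continuous_fieldP (ν c : ℝ) : Continuous (Function.uncurry (fieldP ν c)) := by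
  unfold fieldP Function.uncurry
  fun_prop

theorem abs_fieldP_sub_fieldP_le (ν c s y z : ℝ) :
    |fieldP ν c s y - fieldP ν c s z| ≤ |ν| * |√(2 * y) - √(2 * z)| := by
  rw [← abs_mul]
  exact (congrArg abs (by simp only [fieldP]; ring)).le

namespace IsStepResponse

variable {ν c μ a r : ℝ} {E G : ℝ → ℝ}

/- Run backwards, the oscillator is driven away from rest; the sign of `1 - c a` decides in which
direction, hence which of the fields `fieldP ν c` and `fieldN ν c = fieldP (-ν) c` governs the
energy. -/
theorem isOrbit_backward (h : IsStepResponse ν c E G) (hμ : μ * |1 - c * a| = ν * (1 - c * a))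
    (ha : 1 - c * a ≠ 0) (hG : ∀ t ∈ Ioc 0 r, G (-t) < 0) :
    IsOrbit (fieldP μ c) r (fun t => response c E G a 0 (-t))
      (fun t => -((1 - c * a) * G (-t))) where
  hasDerivAt_position t _ :=
    ((h.hasDerivAt_response_at_rest a (-t)).scomp t (hasDerivAt_neg t)).congr_deriv (by simp)
  hasDerivAt_velocity t ht := by
    have hGt : G (-t) ≤ 0 := by
      rcases ht.1.eq_or_lt with rfl | ht0
      · rw [neg_zero, h.velocity_zero]
      · exact (hG t ⟨ht0, ht.2⟩).le
    have hspeed : √(2 * ((-((1 - c * a) * G (-t))) ^ 2 / 2)) = |1 - c * a| * -G (-t) := by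
      rw [mul_div_cancel₀ _ (two_ne_zero' ℝ), Real.sqrt_sq_eq_abs, abs_neg, abs_mul,
        abs_of_nonpos hGt]
    refine (((h.hasDerivAt_velocity (-t)).scomp t (hasDerivAt_neg t)).const_mul
      (1 - c * a)).neg.congr_deriv ?_
    simp only [fieldP, response, hspeed, smul_eq_mul]
    linear_combination G (-t) * hμ
  velocity_zero := by simp only [neg_zero, h.velocity_zero, mul_zero]
  velocity_ne_zero t ht :=
    neg_ne_zero.2 (mul_ne_zero ha (hG t (Ioo_subset_Ioc_self ht)).ne)

theorem response_neg_mem_solDom (h : IsStepResponse ν c E G)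
    (hμ : μ * |1 - c * a| = ν * (1 - c * a)) (ha : 1 - c * a ≠ 0) (hr : 0 ≤ r)
    (hG : ∀ t ∈ Ioc 0 r, G (-t) < 0) :
    response c E G a 0 (-r) ∈ solDom (fieldP μ c) a := by
  have hmem := (h.isOrbit_backward hμ ha hG).mem_solDom (continuous_fieldP μ c) hr
  rwa [neg_zero, h.response_zero] at hmem

theorem sqrt_two_mul_maxSol_response_neg (h : IsStepResponse ν c E G)
    (hμ : μ * |1 - c * a| = ν * (1 - c * a)) (ha : 1 - c * a ≠ 0) (hr : 0 < r)
    (hG : ∀ t ∈ Ioc 0 r, G (-t) < 0) :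
    √(2 * maxSol (fieldP μ c) a (response c E G a 0 (-r))) = |1 - c * a| * -G (-r) := by
  have hmax := (h.isOrbit_backward hμ ha hG).maxSol_eq (continuous_fieldP μ c) hr.le (abs_nonneg μ)
    (abs_fieldP_sub_fieldP_le μ c)
  rw [neg_zero, h.response_zero] at hmax
  rw [hmax, mul_div_cancel₀ _ (two_ne_zero' ℝ), Real.sqrt_sq_eq_abs, abs_neg, abs_mul,
    abs_of_neg (hG r (right_mem_Ioc.2 hr))]

theorem exists_breaksDownBefore_of_not_P (h : IsStepResponse ν c E G) {s₀ p₀ M : ℝ} (hM : 0 ≤ M)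
    (hpos : ∀ t ∈ Ioo 0 M, 0 < G t) (hneg : ∀ t ∈ Ioo 0 M, G (-t) < 0)
    (hs₀ : s₀ ∈ Ioo 0 (E (-M))) (hviol : ¬(s₀ ∈ domP ν c ∧ -√(2 * P ν c s₀) < p₀)) :
    ∃ T > 0, BreaksDownBefore ν (Ici c) s₀ p₀ T := by
  have hcont : ContinuousOn (fun t => E (-t)) (Icc 0 M) :=
    (h.continuous_position.comp continuous_neg).continuousOn
  obtain ⟨r, hr, rfl⟩ := intermediate_value_Ioo hM hcont (by rwa [neg_zero, h.position_zero])
  have hnegr : ∀ t ∈ Ioc 0 r, G (-t) < 0 := fun t ht => hneg t ⟨ht.1, ht.2.trans_lt hr.2⟩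
  have hμ : ν * |1 - c * 0| = ν * (1 - c * 0) := by simp
  have hmem := h.response_neg_mem_solDom hμ (by simp) hr.1.le hnegr
  have hsqrt := h.sqrt_two_mul_maxSol_response_neg hμ (by simp) hr.1 hnegr
  rw [response_zero_zero] at hmem hsqrt
  have hp₀ : p₀ ≤ G (-r) := by
    refine not_lt.1 fun hlt => hviol ⟨hmem, ?_⟩
    simpa [P, hsqrt] using hlt
  exact ⟨r, hr.1, h.breaksDownBefore_of_velocity_le hr.1
    (fun t ht => hpos t ⟨ht.1, ht.2.trans hr.2⟩) (hpos r hr).le hp₀⟩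

theorem exists_breaksDownBefore_of_not_N (h : IsStepResponse ν c E G) {K : Set ℝ} {s₀ p₀ M L : ℝ}
    (hK : K ⊆ Iic c) (hM : 0 ≤ M) (hpos : ∀ t ∈ Ioo 0 M, 0 < G t)
    (hneg : ∀ t ∈ Ioo 0 M, G (-t) < 0) (hL : 0 ≤ L) (hca : 1 < c * a)
    (ha : ∀ s₀ p₀, a ≤ s₀ → BreaksDownBefore ν K s₀ p₀ L)
    (hs₀ : s₀ ∈ Ioo (response c E G a 0 (-M)) a)
    (hviol : ¬(s₀ ∈ domN ν c a ∧ p₀ < √(2 * N ν c a s₀))) :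
    ∃ T > 0, BreaksDownBefore ν K s₀ p₀ T := by
  have hcont : ContinuousOn (fun t => response c E G a 0 (-t)) (Icc 0 M) :=
    ((h.continuous_response a 0).comp continuous_neg).continuousOn
  obtain ⟨q, hq, rfl⟩ := intermediate_value_Ioo' hM hcont (by rwa [neg_zero, h.response_zero])
  have hnegq : ∀ t ∈ Ioc 0 q, G (-t) < 0 := fun t ht => hneg t ⟨ht.1, ht.2.trans_lt hq.2⟩
  have hsign : 1 - c * a < 0 := sub_neg.2 hca
  have hμ : -ν * |1 - c * a| = ν * (1 - c * a) := by rw [abs_of_neg hsign, neg_mul_neg]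
  have hmem := h.response_neg_mem_solDom hμ hsign.ne hq.1.le hnegq
  have hsqrt := h.sqrt_two_mul_maxSol_response_neg hμ hsign.ne hq.1 hnegq
  rw [abs_of_neg hsign, neg_mul_neg] at hsqrt
  have hp₀ : (1 - c * a) * G (-q) ≤ p₀ :=
    not_lt.1 fun hlt => hviol ⟨hmem, hlt.trans_eq hsqrt.symm⟩
  exact ⟨q + L, by linarith [hq.1], h.breaksDownBefore_of_velocity_ge hK hq.1
    (fun t ht => hpos t ⟨ht.1, ht.2.trans hq.2⟩) (hpos q hq).le hL ha hp₀⟩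

end IsStepResponse

theorem isStepResponse_of_undamped {ν c : ℝ} {φ ψ : ℝ → ℝ} (hc : c ≠ 0)
    (hφ : ∀ t, HasDerivAt φ (ψ t) t) (hψ : ∀ t, HasDerivAt ψ ((ν ^ 2 / 4 - c) * φ t) t)
    (hφ0 : φ 0 = 0) (hψ0 : ψ 0 = 1) :
    IsStepResponse ν c (fun t => (1 - Real.exp (-(ν / 2) * t) * (ψ t + ν / 2 * φ t)) / c)
      (fun t => Real.exp (-(ν / 2) * t) * φ t) := by
  have hexp : ∀ t, HasDerivAt (fun t => Real.exp (-(ν / 2) * t))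
      (Real.exp (-(ν / 2) * t) * -(ν / 2)) t := fun _ =>
    (hasDerivAt_const_mul (-(ν / 2))).exp
  refine ⟨fun t => ?_, fun t => ?_, ?_, ?_⟩
  · refine ((((hexp t).mul ((hψ t).add ((hφ t).const_mul (ν / 2)))).const_sub 1).div_const
      c).congr_deriv ?_
    simp only [Pi.add_apply]
    field_simp
    ring
  · refine ((hexp t).mul (hφ t)).congr_deriv ?_
    field_simp
    ring
  · simp only [mul_zero, Real.exp_zero, hφ0, hψ0, add_zero, mul_one, sub_self, zero_div]
  · simp only [hφ0, mul_zero]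

/-- Half the period of the underdamped oscillator `s'' + ν s' + c s = 0`. -/
noncomputable def halfPeriod (ν c : ℝ) : ℝ := 2 * Real.pi / √(4 * c - ν ^ 2)

theorem halfPeriod_pos {ν c : ℝ} (h : ν ^ 2 < 4 * c) : 0 < halfPeriod ν c :=
  div_pos Real.two_pi_pos (Real.sqrt_pos.2 (sub_pos.2 h))

theorem sqrt_div_two_mul_halfPeriod {ν c : ℝ} (h : ν ^ 2 < 4 * c) :
    √(4 * c - ν ^ 2) / 2 * halfPeriod ν c = Real.pi := by
  have hne := (Real.sqrt_pos.2 (sub_pos.2 h)).ne'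
  rw [halfPeriod]
  field_simp

/-- The step response of an underdamped oscillator, with the behaviour of its velocity during the
half-periods before and after the step. -/
structure IsUnderdampedStepResponse (ν c : ℝ) (E G : ℝ → ℝ) : Prop
    extends IsStepResponse ν c E G where
  velocity_pos : ∀ t ∈ Ioo 0 (halfPeriod ν c), 0 < G t
  velocity_neg_neg : ∀ t ∈ Ioo 0 (halfPeriod ν c), G (-t) < 0
  velocity_halfPeriod : G (halfPeriod ν c) = 0
  position_neg_halfPeriod : E (-halfPeriod ν c) = sTilde ν c
  one_le_mul_position_halfPeriod : 1 ≤ c * E (halfPeriod ν c)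

theorem exists_isUnderdampedStepResponse {ν c : ℝ} (h : ν ^ 2 < 4 * c) :
    ∃ E G, IsUnderdampedStepResponse ν c E G := by
  set ω := √(4 * c - ν ^ 2) / 2 with hω
  have hc : 0 < c := by nlinarith only [h, sq_nonneg ν]
  have hωpos : 0 < ω := half_pos (Real.sqrt_pos.2 (sub_pos.2 h))
  have hωsq : ω ^ 2 = c - ν ^ 2 / 4 := by
    rw [hω, div_pow, Real.sq_sqrt (sub_pos.2 h).le]
    ring
  have hωL : ω * halfPeriod ν c = Real.pi := sqrt_div_two_mul_halfPeriod h
  have hγ : ν / 2 * halfPeriod ν c = Real.pi * ν / √(4 * c - ν ^ 2) := by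
    rw [halfPeriod]
    ring
  have hsin : ∀ t ∈ Ioo 0 (halfPeriod ν c), 0 < Real.sin (ω * t) := fun t ht =>
    Real.sin_pos_of_pos_of_lt_pi (mul_pos hωpos ht.1) (hωL ▸ mul_lt_mul_of_pos_left ht.2 hωpos)
  refine ⟨_, _, isStepResponse_of_undamped (φ := fun t => Real.sin (ω * t) / ω)
    (ψ := fun t => Real.cos (ω * t)) hc.ne' (fun t => ?_) (fun t => ?_) (by simp) (by simp),
    fun t ht => ?_, fun t ht => ?_, ?_, ?_, ?_⟩
  · exact ((hasDerivAt_const_mul ω).sin.div_const ω).congr_deriv (by field_simp)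
  · refine (hasDerivAt_const_mul ω).cos.congr_deriv ?_
    rw [show ν ^ 2 / 4 - c = -ω ^ 2 by rw [hωsq]; ring]
    field_simp
  · exact mul_pos (Real.exp_pos _) (div_pos (hsin t ht) hωpos)
  · rw [mul_neg ω, Real.sin_neg, neg_div]
    exact mul_neg_of_pos_of_neg (Real.exp_pos _) (neg_lt_zero.2 (div_pos (hsin t ht) hωpos))
  · rw [hωL, Real.sin_pi, zero_div, mul_zero]
  · rw [mul_neg ω, hωL, neg_mul_neg, hγ, sTilde, Real.cos_neg, Real.cos_pi, Real.sin_neg,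
      Real.sin_pi]
    ring
  · rw [hωL, Real.cos_pi, Real.sin_pi, mul_div_cancel₀ _ hc.ne', zero_div, mul_zero, add_zero]
    linarith [Real.exp_pos (-(ν / 2) * halfPeriod ν c)]

namespace IsUnderdampedStepResponse

variable {ν c : ℝ} {E G : ℝ → ℝ}

theorem breaksDownBefore_halfPeriod (h : IsUnderdampedStepResponse ν c E G)
    (hL : 0 < halfPeriod ν c) {s₀ p₀ : ℝ} (hs₀ : sTilde ν c ≤ s₀) :
    BreaksDownBefore ν (Ici c) s₀ p₀ (halfPeriod ν c) := by
  refine h.breaksDownBefore_of_response_nonpos hL h.velocity_pos ?_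
  have hrewind := h.response_neg_rewind 0 (-halfPeriod ν c)
  have hgap : (s₀ - sTilde ν c) * (1 - c * E (halfPeriod ν c)) ≤ 0 :=
    mul_nonpos_of_nonneg_of_nonpos (sub_nonneg.2 hs₀)
      (sub_nonpos.2 h.one_le_mul_position_halfPeriod)
  simp only [response, neg_neg, h.velocity_halfPeriod, h.position_neg_halfPeriod] at hrewind ⊢
  linarith

end IsUnderdampedStepResponse

theorem two_le_mul_sTilde {ν c : ℝ} (hν : 0 ≤ ν) (hc : 0 < c) : 2 ≤ c * sTilde ν c := by
  have hexp : 1 ≤ Real.exp (Real.pi * ν / √(4 * c - ν ^ 2)) := Real.one_le_exp (by positivity)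
  rw [sTilde, mul_div_cancel₀ _ hc.ne']
  linarith

theorem exists_undamped_of_nonneg {δ : ℝ} (hδ : 0 ≤ δ) :
    ∃ φ ψ : ℝ → ℝ, (∀ t, HasDerivAt φ (ψ t) t) ∧ (∀ t, HasDerivAt ψ (δ * φ t) t) ∧
      φ 0 = 0 ∧ ψ 0 = 1 ∧ (∀ t, φ (-t) = -φ t) ∧ ∀ t, 0 ≤ t → t ≤ φ t := by
  rcases hδ.eq_or_lt with rfl | hδ
  · exact ⟨id, fun _ => 1, hasDerivAt_id, fun t => (hasDerivAt_const t 1).congr_deriv (by simp),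
      rfl, rfl, fun _ => rfl, fun _ _ => le_rfl⟩
  set ω := √δ with hω
  have hωpos : 0 < ω := Real.sqrt_pos.2 hδ
  refine ⟨fun t => Real.sinh (ω * t) / ω, fun t => Real.cosh (ω * t), fun t => ?_, fun t => ?_,
    by simp, by simp, fun t => ?_, fun t ht => ?_⟩
  · exact ((hasDerivAt_const_mul ω).sinh.div_const ω).congr_deriv (by field_simp)
  · refine (hasDerivAt_const_mul ω).cosh.congr_deriv ?_
    rw [← Real.sq_sqrt hδ.le, ← hω]
    field_simp
  · simp only [mul_neg, Real.sinh_neg, neg_div]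
  · rw [le_div_iff₀ hωpos, mul_comm]
    exact Real.self_le_sinh_iff.2 (by positivity)

theorem exists_isStepResponse_of_overdamped {ν c : ℝ} (hν : 0 ≤ ν) (hc : c ≠ 0)
    (h : 4 * c ≤ ν ^ 2) :
    ∃ E G, IsStepResponse ν c E G ∧ ∀ t > 0, 0 < G t ∧ G (-t) ≤ -t := by
  obtain ⟨φ, ψ, hφ, hψ, hφ0, hψ0, hodd, hle⟩ :=
    exists_undamped_of_nonneg (δ := ν ^ 2 / 4 - c) (by linarith)
  refine ⟨_, _, isStepResponse_of_undamped hc hφ hψ hφ0 hψ0, fun t ht => ?_⟩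
  have hφt : t ≤ φ t := hle t ht.le
  have hexp : 1 ≤ Real.exp (-(ν / 2) * -t) := Real.one_le_exp (by rw [neg_mul_neg]; positivity)
  refine ⟨mul_pos (Real.exp_pos _) (ht.trans_le hφt), ?_⟩
  rw [hodd, mul_neg]
  nlinarith

theorem IsStepResponse.exists_gt_position_neg {ν c : ℝ} {E G : ℝ → ℝ} (h : IsStepResponse ν c E G)
    (hG : ∀ t > 0, G (-t) ≤ -t) {s₀ : ℝ} (hs₀ : 0 < s₀) : ∃ M > 0, s₀ < E (-M) := by
  have hderiv : ∀ t, HasDerivAt (fun t => E (-t) - t ^ 2 / 2) (-G (-t) - t) t := fun t =>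
    (((h.hasDerivAt_position (-t)).scomp t (hasDerivAt_neg t)).sub
      ((hasDerivAt_pow 2 t).div_const 2)).congr_deriv (by simp)
  have hmono : MonotoneOn (fun t => E (-t) - t ^ 2 / 2) (Ici 0) := by
    refine monotoneOn_of_deriv_nonneg (convex_Ici 0)
      (fun t _ => (hderiv t).continuousAt.continuousWithinAt)
      (fun t _ => (hderiv t).differentiableAt.differentiableWithinAt) fun t ht => ?_
    rw [interior_Ici] at ht
    rw [(hderiv t).deriv]
    linarith [hG t ht]
  have hM : 0 < 1 + s₀ := by linarith
  have hle : E (-0) - 0 ^ 2 / 2 ≤ E (-(1 + s₀)) - (1 + s₀) ^ 2 / 2 :=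
    hmono self_mem_Ici hM.le hM.le
  rw [neg_zero, h.position_zero] at hle
  exact ⟨1 + s₀, hM, by nlinarith⟩

theorem exists_breaksDownBefore_of_not_P {ν c s₀ p₀ : ℝ} (hν : 0 ≤ ν) (hc : 0 < c) (hs₀ : 0 < s₀)
    (hviol : ¬(s₀ ∈ domP ν c ∧ -√(2 * P ν c s₀) < p₀)) :
    ∃ T > 0, BreaksDownBefore ν (Ici c) s₀ p₀ T := by
  rcases lt_or_ge (ν ^ 2) (4 * c) with hunder | hover
  · obtain ⟨E, G, h⟩ := exists_isUnderdampedStepResponse hunder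
    have hL := halfPeriod_pos hunder
    rcases le_or_gt (sTilde ν c) s₀ with hle | hlt
    · exact ⟨_, hL, h.breaksDownBefore_halfPeriod hL hle⟩
    · exact h.exists_breaksDownBefore_of_not_P hL.le h.velocity_pos h.velocity_neg_neg
        ⟨hs₀, hlt.trans_eq h.position_neg_halfPeriod.symm⟩ hviol
  · obtain ⟨E, G, h, hG⟩ := exists_isStepResponse_of_overdamped hν hc.ne' hover
    obtain ⟨M, hM, hlt⟩ := h.exists_gt_position_neg (fun t ht => (hG t ht).2) hs₀
    exact h.exists_breaksDownBefore_of_not_P hM.le (fun t ht => (hG t ht.1).1)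
      (fun t ht => (hG t ht.1).2.trans_lt (neg_lt_zero.2 ht.1)) ⟨hs₀, hlt⟩ hviol

theorem exists_breaksDownBefore_of_not_N {ν cm cp s₀ p₀ : ℝ} (hν : 0 ≤ ν) (hcm : ν ^ 2 < 4 * cm)
    (hcp : cm ≤ cp) (hs₀ : 0 < s₀)
    (hviol : ¬(s₀ ∈ domN ν cp (sTilde ν cm) ∧ p₀ < √(2 * N ν cp (sTilde ν cm) s₀))) :
    ∃ T > 0, BreaksDownBefore ν (Icc cm cp) s₀ p₀ T := by
  have hcm0 : 0 < cm := by nlinarith only [hcm, sq_nonneg ν]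
  have hcp4 : ν ^ 2 < 4 * cp := by linarith
  obtain ⟨_, _, hm⟩ := exists_isUnderdampedStepResponse hcm
  obtain ⟨E, G, hp⟩ := exists_isUnderdampedStepResponse hcp4
  have hbreak : ∀ s₀ p₀, sTilde ν cm ≤ s₀ →
      BreaksDownBefore ν (Icc cm cp) s₀ p₀ (halfPeriod ν cm) := fun _ _ hle =>
    (hm.breaksDownBefore_halfPeriod (halfPeriod_pos hcm) hle).mono Icc_subset_Ici_self
  rcases le_or_gt (sTilde ν cm) s₀ with hle | hlt
  · exact ⟨_, halfPeriod_pos hcm, hbreak s₀ p₀ hle⟩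
  have hm2 : 2 ≤ cp * sTilde ν cm := (two_le_mul_sTilde hν hcm0).trans
    (mul_le_mul_of_nonneg_right hcp (by unfold sTilde; positivity))
  have hp2 : 2 ≤ cp * sTilde ν cp := two_le_mul_sTilde hν (hcm0.trans_le hcp)
  have hrest : sTilde ν cm + (1 - cp * sTilde ν cm) * sTilde ν cp ≤ 0 := by
    refine nonpos_of_mul_nonpos_right ?_ (hcm0.trans_le hcp)
    nlinarith only [hm2, hp2]
  refine hp.exists_breaksDownBefore_of_not_N Icc_subset_Iic_self (halfPeriod_pos hcp4).le
    hp.velocity_pos hp.velocity_neg_neg (halfPeriod_pos hcm).le (by linarith) hbreak ⟨?_, hlt⟩ hviol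
  simp only [response, hp.position_neg_halfPeriod]
  linarith

section Slices

variable {f : ℝ → ℝ → ℝ} {I : Set ℝ} {t x : ℝ}

theorem hasDerivAt_slice (hf : DifferentiableWithinAt ℝ (Function.uncurry f) (I ×ˢ univ) (t, x))
    (ht : t ∈ I) :
    HasDerivAt (f t) (fderivWithin ℝ (Function.uncurry f) (I ×ˢ univ) (t, x) (0, 1)) x :=
  hasDerivWithinAt_univ.1 <| hf.hasFDerivWithinAt.comp_hasDerivWithinAt (s := univ) x
    ((hasDerivAt_const x t).prodMk (hasDerivAt_id x)).hasDerivWithinAt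
    fun _ _ => ⟨ht, mem_univ _⟩

theorem differentiableAt_slice (hf : ContDiffOn ℝ 1 (Function.uncurry f) (I ×ˢ univ))
    (ht : t ∈ I) : DifferentiableAt ℝ (f t) x :=
  (hasDerivAt_slice (hf.differentiableOn one_ne_zero _ ⟨ht, mem_univ x⟩) ht).differentiableAt

theorem continuousOn_deriv_slice (hI : UniqueDiffOn ℝ I)
    (hf : ContDiffOn ℝ 1 (Function.uncurry f) (I ×ˢ univ)) :
    ContinuousOn (Function.uncurry fun t x => deriv (f t) x) (I ×ˢ univ) :=
  ((hf.continuousOn_fderivWithin (hI.prod uniqueDiffOn_univ) le_rfl).clm_apply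
    continuousOn_const).congr fun z hz =>
      (hasDerivAt_slice (hf.differentiableOn one_ne_zero z hz) hz.1).deriv

theorem hasDerivAt_comp_curve {X : ℝ → ℝ} {X' : ℝ}
    (hf : DifferentiableAt ℝ (Function.uncurry f) (t, X t)) (hX : HasDerivAt X X' t) :
    HasDerivAt (fun τ => f τ (X τ))
      (deriv (fun τ => f τ (X t)) t + deriv (f t) (X t) * X') t := by
  set D := fderiv ℝ (Function.uncurry f) (t, X t)
  have htime : HasDerivAt (fun τ => f τ (X t)) (D (1, 0)) t :=
    hf.hasFDerivAt.comp_hasDerivAt (f := fun τ => (τ, X t)) t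
      ((hasDerivAt_id t).prodMk (hasDerivAt_const t (X t)))
  have hspace : HasDerivAt (f t) (D (0, 1)) (X t) :=
    hf.hasFDerivAt.comp_hasDerivAt (f := fun y => (t, y)) (X t)
      ((hasDerivAt_const (X t) t).prodMk (hasDerivAt_id (X t)))
  have hcurve : HasDerivAt (fun τ => f τ (X τ)) (D (1, X')) t :=
    hf.hasFDerivAt.comp_hasDerivAt (f := fun τ => (τ, X τ)) t ((hasDerivAt_id t).prodMk hX)
  have hsplit : ((1 : ℝ), X') = (1, 0) + X' • (0, 1) := by simp
  rw [htime.deriv, hspace.deriv]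
  refine hcurve.congr_deriv ?_
  rw [hsplit, map_add, map_smul, smul_eq_mul, mul_comm]

theorem continuousOn_comp_curve {J : Set ℝ} {X : ℝ → ℝ}
    (hf : ContinuousOn (Function.uncurry f) (I ×ˢ univ)) (hJ : J ⊆ I) (hX : ContinuousOn X J) :
    ContinuousOn (fun t => f t (X t)) J :=
  hf.comp (f := fun t => (t, X t)) (continuousOn_id.prodMk hX) fun _ ht => ⟨hJ ht, mem_univ _⟩

end Slices

theorem tendsto_add_fst_prod {X : ℝ → ℝ} {t : ℝ} (hX : ContinuousAt X t) :
    Tendsto (fun q : ℝ × ℝ => X q.2 + q.1) (𝓝[≠] 0 ×ˢ 𝓝 t) (𝓝 (X t)) := by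
  simpa only [Function.comp_apply, add_zero] using
    (hX.tendsto.comp (tendsto_snd (f := 𝓝[≠] (0 : ℝ)))).add
      (tendsto_fst.mono_right nhdsWithin_le_nhds)

theorem tendsto_diffQuotient_prod {g g' : ℝ → ℝ → ℝ} {X : ℝ → ℝ} {t : ℝ}
    (hg : ∀ᶠ τ in 𝓝 t, ∀ y, HasDerivAt (g τ) (g' τ y) y)
    (hg' : ContinuousAt (Function.uncurry g') (t, X t)) (hX : ContinuousAt X t) :
    Tendsto (fun q : ℝ × ℝ => (g q.2 (X q.2 + q.1) - g q.2 (X q.2)) / q.1)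
      (𝓝[≠] 0 ×ˢ 𝓝 t) (𝓝 (g' t (X t))) := by
  set l : Filter (ℝ × ℝ) := 𝓝[≠] 0 ×ˢ 𝓝 t
  have htime : Tendsto Prod.snd l (𝓝 t) := tendsto_snd
  have hleft : Tendsto (fun q : ℝ × ℝ => X q.2) l (𝓝 (X t)) := hX.tendsto.comp htime
  have hright : Tendsto (fun q : ℝ × ℝ => X q.2 + q.1) l (𝓝 (X t)) := tendsto_add_fst_prod hX
  have hmvt : ∀ q : ℝ × ℝ, (∀ y, HasDerivAt (g q.2) (g' q.2 y) y) →
      ∃ ξ ∈ uIcc (X q.2) (X q.2 + q.1),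
        g q.2 (X q.2 + q.1) - g q.2 (X q.2) = g' q.2 ξ * q.1 := fun q hq => by
    simpa only [id, add_sub_cancel_left] using exists_mem_uIcc_sub_eq_mul_sub (S := id)
      (Y := g q.2) (V := fun _ => 1) (m := g' q.2) (a := X q.2 ⊓ (X q.2 + q.1))
      (b := X q.2 ⊔ (X q.2 + q.1)) (x := X q.2) (y := X q.2 + q.1) (fun y _ => hasDerivAt_id y)
      (fun y _ => (hq y).congr_deriv (one_mul _).symm) (fun _ _ => one_ne_zero)
      left_mem_uIcc right_mem_uIcc
  choose! ξ hξ hslope using hmvt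
  have hgood : ∀ᶠ q in l, ∀ y, HasDerivAt (g q.2) (g' q.2 y) y := htime.eventually hg
  have hξlim : Tendsto ξ l (𝓝 (X t)) := fun s hs => by
    rw [mem_map]
    filter_upwards [hgood, tendsto_smallSets_iff.1 (hleft.uIcc hright) s hs] with q hq hsub
    exact hsub (hξ q hq)
  refine (hg'.tendsto.comp (htime.prodMk_nhds hξlim)).congr' ?_
  have hne : ∀ᶠ q in l, q.1 ≠ 0 := tendsto_fst.eventually self_mem_nhdsWithin
  filter_upwards [hgood, hne] with q hq hq0
  rw [hslope q hq, mul_div_cancel_right₀ _ hq0]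
  rfl

theorem tendstoUniformlyOnFilter_of_tendsto_prod {α ι β : Type*} [UniformSpace β]
    {F : ι → α → β} {f : α → β} {p : Filter ι} {p' : Filter α} {a : β}
    (hF : Tendsto (Function.uncurry F) (p ×ˢ p') (𝓝 a)) (hf : Tendsto f p' (𝓝 a)) :
    TendstoUniformlyOnFilter F f p p' :=
  tendstoUniformlyOnFilter_iff_tendsto.2
    (((hf.comp tendsto_snd).prodMk_nhds hF).mono_right (nhds_le_uniformity a))

theorem hasDerivAt_diffQuotient_along {u g : ℝ → ℝ → ℝ} {X : ℝ → ℝ} {t h : ℝ}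
    (hu : ∀ y, DifferentiableAt ℝ (Function.uncurry u) (t, y))
    (hburgers : ∀ y, deriv (fun τ => u τ y) t + u t y * deriv (u t) y = g t y)
    (hX : HasDerivAt X (u t (X t)) t) :
    HasDerivAt (fun τ => (u τ (X τ + h) - u τ (X τ)) / h)
      ((g t (X t + h) - g t (X t)) / h
        - deriv (u t) (X t + h) * ((u t (X t + h) - u t (X t)) / h)) t := by
  have hshift : HasDerivAt (fun τ => u τ (X τ + h))
      (g t (X t + h) - deriv (u t) (X t + h) * (u t (X t + h) - u t (X t))) t :=
    (hasDerivAt_comp_curve (hu _) (hX.add_const h)).congr_deriv (by rw [← hburgers]; ring)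
  have hbase : HasDerivAt (fun τ => u τ (X τ)) (g t (X t)) t :=
    (hasDerivAt_comp_curve (hu _) hX).congr_deriv (by rw [← hburgers]; ring)
  exact ((hshift.sub hbase).div_const h).congr_deriv (by ring)

/- `u` is only `C¹`, so the equation cannot be differentiated in `x`; its difference quotients
along the characteristic can be differentiated in time, and their derivatives converge uniformly. -/
theorem hasDerivAt_deriv_along {u g g' : ℝ → ℝ → ℝ} {X : ℝ → ℝ} {I : Set ℝ} (hI : IsOpen I)
    (hu : ContDiffOn ℝ 1 (Function.uncurry u) (I ×ˢ univ))
    (hburgers : ∀ t ∈ I, ∀ x, deriv (fun τ => u τ x) t + u t x * deriv (u t) x = g t x)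
    (hg : ∀ t ∈ I, ∀ x, HasDerivAt (g t) (g' t x) x)
    (hg' : ContinuousOn (Function.uncurry g') (I ×ˢ univ))
    {t : ℝ} (ht : t ∈ I) (hX : IsIntegralCurveAt X u t) :
    HasDerivAt (fun t => deriv (u t) (X t)) (g' t (X t) - deriv (u t) (X t) ^ 2) t := by
  have hnhds : ∀ {τ x : ℝ}, τ ∈ I → I ×ˢ univ ∈ 𝓝 (τ, x) := fun hτ =>
    prod_mem_nhds (hI.mem_nhds hτ) univ_mem
  have hnear : ∀ᶠ τ in 𝓝 t, τ ∈ I := hI.mem_nhds ht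
  have hux : ∀ τ ∈ I, ∀ x, HasDerivAt (u τ) (deriv (u τ) x) x := fun τ hτ x =>
    (differentiableAt_slice hu hτ).hasDerivAt
  have hucont : ContinuousAt (Function.uncurry fun t x => deriv (u t) x) (t, X t) :=
    (continuousOn_deriv_slice hI.uniqueDiffOn hu).continuousAt (hnhds ht)
  have hg'cont : ContinuousAt (Function.uncurry g') (t, X t) := hg'.continuousAt (hnhds ht)
  have hXcont : ContinuousAt X t := hX.hasDerivAt.continuousAt
  have hquot := tendsto_diffQuotient_prod (hnear.mono hux) hucont hXcont
  have hforce := tendsto_diffQuotient_prod (hnear.mono hg) hg'cont hXcont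
  have hslope : Tendsto (fun q : ℝ × ℝ => deriv (u q.2) (X q.2 + q.1)) (𝓝[≠] 0 ×ˢ 𝓝 t)
      (𝓝 (deriv (u t) (X t))) :=
    hucont.tendsto.comp (tendsto_snd.prodMk_nhds (tendsto_add_fst_prod hXcont))
  have hlimit : Tendsto (fun τ => g' τ (X τ) - deriv (u τ) (X τ) ^ 2) (𝓝 t)
      (𝓝 (g' t (X t) - deriv (u t) (X t) ^ 2)) :=
    (hg'cont.tendsto.comp (tendsto_id.prodMk_nhds hXcont.tendsto)).sub
      ((hucont.tendsto.comp (tendsto_id.prodMk_nhds hXcont.tendsto)).pow 2)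
  refine hasDerivAt_of_tendstoUniformlyOnFilter (l := 𝓝[≠] (0 : ℝ))
    (f := fun h τ => (u τ (X τ + h) - u τ (X τ)) / h)
    (f' := fun h τ => (g τ (X τ + h) - g τ (X τ)) / h
      - deriv (u τ) (X τ + h) * ((u τ (X τ + h) - u τ (X τ)) / h))
    (g' := fun τ => g' τ (X τ) - deriv (u τ) (X τ) ^ 2)
    (tendstoUniformlyOnFilter_of_tendsto_prod ?_ hlimit) ?_ ?_
  · simpa only [Function.uncurry_def, sq] using hforce.sub (hslope.mul hquot)
  · filter_upwards [tendsto_snd.eventually (hnear.and hX)] with q ⟨hq, hXq⟩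
    have hdiff := fun y =>
      (hu.differentiableOn one_ne_zero).differentiableAt (hnhds (x := y) hq)
    exact hasDerivAt_diffQuotient_along hdiff (hburgers _ hq) hXq
  · filter_upwards [hnear] with τ hτ
    simpa only [smul_eq_mul, inv_mul_eq_div] using (hux τ hτ (X τ)).tendsto_slope_zero

theorem exists_isIntegralCurveOn_Icc {E : Type*} [NormedAddCommGroup E] [NormedSpace ℝ E]
    [CompleteSpace E] {v : ℝ → E → E} {a b : ℝ} {K M : NNReal} (hab : a ≤ b) (x₀ : E)
    (hlip : ∀ t ∈ Icc a b, LipschitzWith K (v t)) (hcont : ∀ x, ContinuousOn (v · x) (Icc a b))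
    (hM : ∀ t ∈ Icc a b, ∀ x, ‖v t x‖ ≤ M) :
    ∃ X : ℝ → E, X a = x₀ ∧ IsIntegralCurveOn X v (Icc a b) := by
  have hPL : IsPicardLindelof v (tmin := a) (tmax := b) ⟨a, left_mem_Icc.2 hab⟩ x₀
      (M * (b - a).toNNReal) 0 M K :=
    { lipschitzOnWith := fun t ht => (hlip t ht).lipschitzOnWith
      continuousOn := fun x _ => hcont x
      norm_le := fun t ht x _ => hM t ht x
      mul_max_le := by simp [hab] }
  exact hPL.exists_eq_forall_mem_Icc_hasDerivWithinAt₀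

theorem pos_of_hasDerivAt_neg_mul {b M : ℝ} {r d : ℝ → ℝ} (hr : ContinuousOn r (Icc 0 b))
    (hd : ∀ t ∈ Ioo 0 b, HasDerivAt r (-(r t * d t)) t) (hM : ∀ t ∈ Ioo 0 b, d t ≤ M)
    (h0 : 0 < r 0) : ∀ t ∈ Icc 0 b, 0 < r t := by
  have hmono : MonotoneOn (fun t => r t ^ 2 * Real.exp (2 * M * t)) (Icc 0 b) := by
    refine monotoneOn_of_hasDerivWithinAt_nonneg (convex_Icc _ _) (by fun_prop)
      (f' := fun t => 2 * (r t ^ 2 * Real.exp (2 * M * t)) * (M - d t)) ?_ ?_ <;>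
      intro t ht <;> rw [interior_Icc] at ht
    · have hexp : HasDerivAt (fun t => Real.exp (2 * M * t)) (Real.exp (2 * M * t) * (2 * M)) t :=
        ((hasDerivAt_id t).const_mul (2 * M)).exp.congr_deriv (by rw [mul_one, id])
      exact ((((hd t ht).fun_pow 2).mul hexp).congr_deriv (by push_cast; ring)).hasDerivWithinAt
    · exact mul_nonneg (by positivity) (sub_nonneg.2 (hM t ht))
  have hne : ∀ t ∈ Icc 0 b, r t ≠ 0 := fun t ht hrt => by
    have hle := hmono (left_mem_Icc.2 (ht.1.trans ht.2)) ht ht.1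
    have hpos : 0 < r 0 ^ 2 * Real.exp (2 * M * 0) := by positivity
    simp only [hrt, zero_pow two_ne_zero, zero_mul] at hle
    exact hle.not_gt hpos
  intro t ht
  by_contra! hle
  obtain ⟨τ, hτ, hrτ⟩ := intermediate_value_Icc' ht.1 (hr.mono (Icc_subset_Icc_right ht.2))
    ⟨hle, h0.le⟩
  exact hne τ ⟨hτ.1, hτ.2.trans ht.2⟩ hrτ

theorem IsClassC1.exists_bound {f : ℝ → ℝ → ℝ} {T b : ℝ} (hf : IsClassC1 T f) (hb : b < T) :
    ∃ M : NNReal, ∀ t ∈ Icc 0 b, ∀ x, |f t x| ≤ M ∧ |deriv (f t) x| ≤ M := by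
  obtain ⟨M, hM⟩ := hf.2 b hb
  refine ⟨M.toNNReal, fun t ht x => ?_⟩
  have := (hM t ht x).trans (Real.le_coe_toNNReal M)
  constructor <;> linarith [abs_nonneg (f t x), abs_nonneg (deriv (f t) x),
    abs_nonneg (derivWithin (fun τ => f τ x) (Ico 0 T) t)]

theorem IsClassC1.exists_characteristic {u : ℝ → ℝ → ℝ} {T b : ℝ} (hu : IsClassC1 T u)
    (hb₀ : 0 ≤ b) (hb : b < T) (x : ℝ) : ∃ X, X 0 = x ∧ IsIntegralCurveOn X u (Icc 0 b) := by
  have hsub : Icc 0 b ⊆ Ico 0 T := Icc_subset_Ico_right hb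
  obtain ⟨M, hM⟩ := hu.exists_bound hb
  refine exists_isIntegralCurveOn_Icc hb₀ x (K := M) (M := M) (fun t ht => ?_)
    (fun y => continuousOn_comp_curve hu.1.continuousOn hsub continuousOn_const)
    fun t ht y => (hM t ht y).1
  exact lipschitzWith_of_nnnorm_deriv_le (fun y => differentiableAt_slice hu.1 (hsub ht))
    fun y => (hM t ht y).2

section Solution

variable {k ν T t : ℝ} {c ρ u : ℝ → ℝ → ℝ} {X : ℝ → ℝ}

theorem IsC1Solution.hasDerivAt_density (hsol : IsC1Solution k ν c T ρ u) (ht : t ∈ Ioo 0 T)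
    (hX : HasDerivAt X (u t (X t)) t) :
    HasDerivAt (fun t => ρ t (X t)) (-(ρ t (X t) * deriv (u t) (X t))) t := by
  obtain ⟨-, hρ, hu, φ, hφ⟩ := hsol
  have hmem : t ∈ Ico 0 T := Ioo_subset_Ico_self ht
  have hdiff : DifferentiableAt ℝ (Function.uncurry ρ) (t, X t) :=
    (hρ.1.differentiableOn one_ne_zero).differentiableAt
      (prod_mem_nhds (Ico_mem_nhds ht.1 ht.2) univ_mem)
  have hflux : deriv (fun y => ρ t y * u t y) (X t)
      = deriv (ρ t) (X t) * u t (X t) + ρ t (X t) * deriv (u t) (X t) :=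
    deriv_fun_mul (differentiableAt_slice hρ.1 hmem) (differentiableAt_slice hu.1 hmem)
  exact (hasDerivAt_comp_curve hdiff hX).congr_deriv
    (by linear_combination (hφ t ht (X t)).1 - hflux)

theorem IsC1Solution.hasDerivAt_velocityGradient (hsol : IsC1Solution k ν c T ρ u)
    (hc : ContinuousOn (Function.uncurry c) (Ioo 0 T ×ˢ univ)) (ht : t ∈ Ioo 0 T)
    (hX : IsIntegralCurveAt X u t) :
    HasDerivAt (fun t => deriv (u t) (X t))
      (-ν * deriv (u t) (X t) + k * (ρ t (X t) - c t (X t)) - deriv (u t) (X t) ^ 2) t := by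
  obtain ⟨-, hρ, hu, φ, hφ⟩ := hsol
  have hsub : Ioo 0 T ×ˢ (univ : Set ℝ) ⊆ Ico 0 T ×ˢ univ :=
    prod_mono_left Ioo_subset_Ico_self
  have hu' : ContDiffOn ℝ 1 (Function.uncurry u) (Ioo 0 T ×ˢ univ) := hu.1.mono hsub
  have hux := continuousOn_deriv_slice isOpen_Ioo.uniqueDiffOn hu'
  refine hasDerivAt_deriv_along isOpen_Ioo hu' (g := fun t x => -ν * u t x - k * deriv (φ t) x)
    (g' := fun t x => -ν * deriv (u t) x + k * (ρ t x - c t x))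
    (fun t ht x => (hφ t ht x).2.1) (fun t ht x => ?_) ?_ ht hX
  · have hvel := (differentiableAt_slice hu' ht (x := x)).hasDerivAt
    exact ((hvel.const_mul (-ν)).sub ((hφ t ht x).2.2.2.const_mul k)).congr_deriv (by ring)
  · exact (continuousOn_const.mul hux).add
      (continuousOn_const.mul ((hρ.1.continuousOn.mono hsub).sub hc))

theorem IsC1Solution.density_pos {b : ℝ} (hsol : IsC1Solution k ν c T ρ u) (hb : b < T)
    (hX : IsIntegralCurveOn X u (Icc 0 b)) (h₀ : 0 < ρ 0 (X 0)) : ∀ t ∈ Icc 0 b, 0 < ρ t (X t) := by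
  obtain ⟨M, hM⟩ := hsol.2.2.1.exists_bound hb
  exact pos_of_hasDerivAt_neg_mul
    (continuousOn_comp_curve hsol.2.1.1.continuousOn (Icc_subset_Ico_right hb)
      fun t ht => (hX t ht).continuousWithinAt)
    (fun t ht => hsol.hasDerivAt_density (Ioo_subset_Ioo_right hb.le ht)
      (hX.isIntegralCurveAt (Icc_mem_nhds ht.1 ht.2)).hasDerivAt)
    (fun t ht => (abs_le.1 (hM t (Ioo_subset_Icc_self ht) (X t)).2).2) h₀

/- For `s = 1 / ρ` and `p = s ∂ₓu` along a characteristic, the quadratic term of the Riccati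
equation for `∂ₓu` cancels and the system becomes linear. -/
theorem IsC1Solution.exists_isTrajectory {cm cp b x : ℝ} (hsol : IsC1Solution 1 ν c T ρ u)
    (hc_cont : ContinuousOn (Function.uncurry c) (Ioo 0 T ×ˢ univ))
    (hc : ∀ t ∈ Ioo 0 T, ∀ x, c t x ∈ Icc cm cp) (hb₀ : 0 ≤ b) (hb : b < T) (hx : 0 < ρ 0 x) :
    ∃ s p, IsTrajectory ν (Icc cm cp) b s p ∧ s 0 = 1 / ρ 0 x ∧ p 0 = deriv (u 0) x / ρ 0 x := by
  have hρ : IsClassC1 T ρ := hsol.2.1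
  have hu : IsClassC1 T u := hsol.2.2.1
  obtain ⟨X, hX₀, hX⟩ := hu.exists_characteristic hb₀ hb x
  have hXcont : ContinuousOn X (Icc 0 b) := fun t ht => (hX t ht).continuousWithinAt
  have hXat : ∀ t ∈ Ioo 0 b, IsIntegralCurveAt X u t := fun t ht =>
    hX.isIntegralCurveAt (Icc_mem_nhds ht.1 ht.2)
  have hclosed : Icc 0 b ⊆ Ico 0 T := Icc_subset_Ico_right hb
  have hopen : Ioo 0 b ⊆ Ioo 0 T := Ioo_subset_Ioo_right hb.le
  have hρX : ContinuousOn (fun t => ρ t (X t)) (Icc 0 b) :=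
    continuousOn_comp_curve hρ.1.continuousOn hclosed hXcont
  have huX : ContinuousOn (fun t => deriv (u t) (X t)) (Icc 0 b) :=
    continuousOn_comp_curve (continuousOn_deriv_slice (uniqueDiffOn_Ico 0 T) hu.1) hclosed hXcont
  have hdensity : ∀ t ∈ Ioo 0 b,
      HasDerivAt (fun t => ρ t (X t)) (-(ρ t (X t) * deriv (u t) (X t))) t := fun t ht =>
    hsol.hasDerivAt_density (hopen ht) (hXat t ht).hasDerivAt
  have hpos : ∀ t ∈ Icc 0 b, 0 < ρ t (X t) := hsol.density_pos hb hX (by rwa [hX₀])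
  have hs : ContinuousOn (fun t => 1 / ρ t (X t)) (Icc 0 b) :=
    continuousOn_const.div hρX fun t ht => (hpos t ht).ne'
  have hs' : ∀ t ∈ Ioo 0 b,
      HasDerivAt (fun t => 1 / ρ t (X t)) (deriv (u t) (X t) / ρ t (X t)) t := fun t ht => by
    have hne := (hpos t (Ioo_subset_Icc_self ht)).ne'
    exact ((hasDerivAt_const t 1).div (hdensity t ht) hne).congr_deriv (by field_simp; ring)
  refine ⟨fun t => 1 / ρ t (X t), fun t => deriv (u t) (X t) / ρ t (X t),
    ⟨hs, huX.div hρX fun t ht => (hpos t ht).ne', hs', fun t ht => ?_,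
      fun t ht => one_div_pos.2 (hpos t ht)⟩, by simp only [hX₀], by simp only [hX₀]⟩
  have hne := (hpos t (Ioo_subset_Icc_self ht)).ne'
  have hgrad := hsol.hasDerivAt_velocityGradient hc_cont (hopen ht) (hXat t ht)
  exact ⟨c t (X t), hc t (hopen ht) _,
    (hgrad.div (hdensity t ht) hne).congr_deriv (by field_simp; ring)⟩

end Solution

theorem exists_breaksDownBefore {ν cm cp s₀ p₀ : ℝ} (hν : 0 ≤ ν) (hcm : 0 < cm) (hcp : cm ≤ cp)
    (hs₀ : 0 < s₀)
    (hviol : ¬((s₀ ∈ domP ν cm ∧ -√(2 * P ν cm s₀) < p₀) ∧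
      (ν < 2 * √cm → s₀ ∈ domN ν cp (sTilde ν cm) ∧ p₀ < √(2 * N ν cp (sTilde ν cm) s₀)))) :
    ∃ T > 0, BreaksDownBefore ν (Icc cm cp) s₀ p₀ T := by
  rcases not_and_or.1 hviol with hP | hN
  · obtain ⟨T, hT, hbreak⟩ := exists_breaksDownBefore_of_not_P hν hcm hs₀ hP
    exact ⟨T, hT, hbreak.mono Icc_subset_Ici_self⟩
  · obtain ⟨hlt, hN⟩ := Classical.not_imp.1 hN
    have hunder : ν ^ 2 < 4 * cm := by
      nlinarith [Real.sq_sqrt hcm.le]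
    exact exists_breaksDownBefore_of_not_N hν hunder hcp hs₀ hN

end EulerPoisson

theorem theorem1p6 (ν cm cp : ℝ) (hν : 0 ≤ ν) (hcm : 0 < cm)
    (c : ℝ → ℝ → ℝ)
    (hc_cont : ContinuousOn (Function.uncurry c) (Set.Ici 0 ×ˢ Set.univ))
    (hc : ∀ t, 0 ≤ t → ∀ x, cm ≤ c t x ∧ c t x ≤ cp)
    (ρ₀ u₀ : ℝ → ℝ) (x : ℝ) (hρ₀ : 0 < ρ₀ x)
    (hviol : ¬ ((1 / ρ₀ x ∈ EulerPoisson.domP ν cm ∧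
          -(ρ₀ x) * √(2 * EulerPoisson.P ν cm (1 / ρ₀ x)) < deriv u₀ x) ∧
        (ν < 2 * √cm →
          1 / ρ₀ x ∈ EulerPoisson.domN ν cp (EulerPoisson.sTilde ν cm) ∧
          deriv u₀ x <
            ρ₀ x * √(2 * EulerPoisson.N ν cp (EulerPoisson.sTilde ν cm) (1 / ρ₀ x))))) :
    ∃ Tstar : ℝ, 0 < Tstar ∧
      ∀ (T : ℝ) (ρ u : ℝ → ℝ → ℝ), EulerPoisson.IsC1Solution 1 ν c T ρ u →
        (∀ y, ρ 0 y = ρ₀ y ∧ u 0 y = u₀ y) → T ≤ Tstar := by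
  have hcp : cm ≤ cp := (hc 0 le_rfl 0).1.trans (hc 0 le_rfl 0).2
  obtain ⟨Tstar, hTstar, hbreak⟩ := EulerPoisson.exists_breaksDownBefore (s₀ := 1 / ρ₀ x)
    (p₀ := deriv u₀ x / ρ₀ x) hν hcm hcp (one_div_pos.2 hρ₀) (by
      rwa [lt_div_iff₀ hρ₀, div_lt_iff₀ hρ₀, neg_mul, mul_comm _ (ρ₀ x), ← neg_mul,
        mul_comm _ (ρ₀ x)])
  refine ⟨Tstar, hTstar, fun T ρ u hsol hinit => ?_⟩
  by_contra! hlt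
  have hnonneg : Set.Ioo 0 T ⊆ Set.Ici 0 := fun t ht => ht.1.le
  obtain ⟨s, p, htraj, hs₀, hp₀⟩ := hsol.exists_isTrajectory (x := x)
    (hc_cont.mono (Set.prod_mono_left hnonneg)) (fun t ht => hc t (hnonneg ht)) hTstar.le hlt
    (by rwa [(hinit x).1])
  have hu₀ : u 0 = u₀ := funext fun y => (hinit y).2
  rw [(hinit x).1] at hs₀ hp₀
  rw [hu₀] at hp₀
  exact lt_irrefl Tstar (hbreak Tstar s p htraj hs₀ hp₀)
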